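/- Let $G$ be a finite directed multigraph without loops, connected as an undirected graph, with vertex set $V(G)$, $n=|V(G)|$, and set of oriented edges $\mathbb{E}(G)$ (an undirected graph is regarded as directed by including both orientations of each edge). Write $e_-$ and $e_+$ for the tail and the head of $e\in\mathbb{E}(G)$. Fix a vertex $q$, a field $k$, and let $\mathbf{S}=k[y_e : e\in \mathbb{E}(G)]$. For $A\subseteq V(G)$ put $\mathbb{E}(A,A^c)=\{e\in\mathbb{E}(G) : e_+\in A,\ e_-\notin A\}$. The oriented cut ideal $\mathcal{C}_G^q\subset\mathbf{S}$ is generated by the monomials $\prod_{e\in\mathbb{E}(A,A^c)}y_e$, over all $A$ with $q\notin A$ such that $A$ and $A^c$ induce connected subgraphs of the underlying undirected graph. Let $\Sigma_G^q$ be the simplicial complex on $\{y_e : e\in\mathbb{E}(G)\}$ with Stanley–Reisner ideal $\mathcal{C}_G^q$ (its faces are the sets whose squarefree monomial is not in $\mathcal{C}_G^q$), and let $k[\Sigma_G^q]=\mathbf{S}/\mathcal{C}_G^q$. An oriented spanning tree of $G$ is a connected subgraph $T$ on all of $V(G)$ with exactly $n-1$ oriented edges, without directed cycles, whose unique source (vertex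 that no edge of $T$ enters) is $q$; let $\mathcal{O}_T\subseteq\mathbb{E}(G)$ be its set of oriented edges. Then: (i) The map $T\mapsto\tau_T=\{y_e : e\in\mathbb{E}(G)\setminus\mathcal{O}_T\}$ is a bijection from the oriented spanning trees of $G$ to the facets of $\Sigma_G^q$; in particular the two sets have the same number of elements. (ii) For each oriented spanning tree $T$ let $P_T=\langle y_e : e\in\mathcal{O}_T\rangle$. Then $\mathcal{C}_G^q=\bigcap_T P_T$, the intersection being over all oriented spanning trees of $G$, and this is the minimal prime decomposition: $T\mapsto P_T$ is a bijection from the oriented spanning trees to the minimal primes of $\mathcal{C}_G^q$. (An empty intersection is the unit ideal.) (iii) Every facet $\tau$ of $\Sigma_G^q$ satisfies $|\tau|=|\mathbb{E}(G)|-n+1$. If every vertex can be reached from $q$ by a directed path, then the Krull dimension of $k[\Sigma_G^q]$ is $|\mathbb{E}(G)|-n+1$. (iv) $\Sigma_G^q$ is Cohen–Macaulay over $k$, i.e. the ring $k[\Sigma_G^q]$ is Cohen–Macaulay (where the zero ring counts as Cohen–Macaulay). -/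

import Mathlib

noncomputable section

/-- A directed multigraph without loops: vertex type `V`, type of oriented edges `E`; the oriented
edge `e` goes from `tail e` to `head e`.  An undirected multigraph is the case in which every edge
is present together with its inverse. -/
structure DirectedMultigraph (V E : Type*) where
  tail : E → V
  head : E → V
  loopless : ∀ e, tail e ≠ head e

namespace DirectedMultigraph

variable {V E : Type*} (G : DirectedMultigraph V E)

/-- One step along an oriented edge belonging to `T`. -/
def Step (T : Set E) (a b : V) : Prop := ∃ e ∈ T, G.tail e = a ∧ G.head e = b

/-- There is a directed walk (possibly of length zero) from `a` to `b`. -/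
def Reaches (a b : V) : Prop := Relation.ReflTransGen (G.Step Set.univ) a b

/-- The simple graph on `V` obtained from the edges in `T` by forgetting orientations and
multiplicities. It is only used to speak about connectedness. -/
def underlying (T : Set E) : SimpleGraph V := SimpleGraph.fromRel (G.Step T)

/-- `G` is connected as an undirected graph. -/
def IsConnected : Prop := (G.underlying Set.univ).Connected

/-- The induced subgraph on the vertex set `A` is connected (so `A` is nonempty). -/
def InducesConnected (A : Set V) : Prop := ((G.underlying Set.univ).induce A).Connected

/-- The vertex `v` is a source of the subgraph with edge set `T`: no edge of `T` enters `v`. -/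
def IsSourceOf (T : Set E) (v : V) : Prop := ∀ e ∈ T, G.head e ≠ v

/-- An oriented spanning tree rooted at `q`, given by its set `T` of oriented edges:
a connected subgraph on all of `V` with `|V| - 1` edges, without directed cycles,
whose unique source is `q`. -/
structure IsOrientedSpanningTree [Fintype V] (q : V) (T : Finset E) : Prop where
  connected : (G.underlying (T : Set E)).Connected
  card_add_one : T.card + 1 = Fintype.card V
  acyclic : ∀ v, ¬ Relation.TransGen (G.Step (T : Set E)) v v
  unique_source : ∀ v, G.IsSourceOf (T : Set E) v ↔ v = q

/-- The cut `𝔼(A, Aᶜ)`: the oriented edges with head in `A` and tail outside `A`. -/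
def cut [Fintype E] [DecidableEq V] (A : Finset V) : Finset E :=
  Finset.univ.filter fun e => G.head e ∈ A ∧ G.tail e ∉ A

/-- The oriented cut ideal: generated by the monomials `∏_{e ∈ 𝔼(A, Aᶜ)} y_e` of the connected
cuts with `q ∈ Aᶜ`. -/
def cutIdeal [Fintype E] [DecidableEq V] (k : Type*) [Field k] (q : V) :
    Ideal (MvPolynomial E k) :=
  Ideal.span {m | ∃ A : Finset V, q ∉ A ∧ G.InducesConnected (A : Set V) ∧
    G.InducesConnected ((A : Set V)ᶜ) ∧ m = ∏ e ∈ G.cut A, MvPolynomial.X e}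

/-- The ideal `P_T` generated by the variables `y_e`, `e ∈ T`. -/
def treeIdeal (k : Type*) [Field k] (T : Finset E) : Ideal (MvPolynomial E k) :=
  Ideal.span (MvPolynomial.X '' (T : Set E))

end DirectedMultigraph

/-- An abstract simplicial complex on the vertex set `E`, as in Stanley–Reisner theory: a family of
finite sets closed under taking subsets.  Elements of `E` need not be faces, the empty set is a face
as soon as there is a face, and the void complex (no face at all) is allowed; it corresponds to the
unit ideal. -/
structure SRComplex (E : Type*) where
  faces : Set (Finset E)
  down_closed : ∀ {s t : Finset E}, s ∈ faces → t ⊆ s → t ∈ faces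

namespace SRComplex

variable {E : Type*}

/-- The facets: faces that are maximal under inclusion. -/
def facets (K : SRComplex E) : Set (Finset E) := {s | Maximal (· ∈ K.faces) s}

/-- The Stanley–Reisner ideal `I_Σ`, generated by the monomials of the non-faces. -/
def srIdeal (K : SRComplex E) (k : Type*) [Field k] : Ideal (MvPolynomial E k) :=
  Ideal.span {m | ∃ s : Finset E, s ∉ K.faces ∧ m = ∏ e ∈ s, MvPolynomial.X e}

/-- The Stanley–Reisner ring (face ring) `k[Σ]`. -/
abbrev FaceRing (K : SRComplex E) (k : Type*) [Field k] : Type _ :=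
  MvPolynomial E k ⧸ K.srIdeal k

/-- The simplicial complex attached to an ideal of a polynomial ring: the faces are the sets whose
squarefree monomial is not in the ideal. -/
def ofIdeal {k : Type*} [Field k] (I : Ideal (MvPolynomial E k)) : SRComplex E where
  faces := {s | ∏ e ∈ s, MvPolynomial.X e ∉ I}
  down_closed := fun {_ _} hs hts ht => hs (I.mem_of_dvd (Finset.prod_dvd_prod_of_subset _ _ _ hts) ht)

end SRComplex

/-- The simplicial complex `Σ_G^q` of the oriented cut ideal. -/
def DirectedMultigraph.cutComplex {V E : Type*} (G : DirectedMultigraph V E) [Fintype E]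
    [DecidableEq V] (k : Type*) [Field k] (q : V) : SRComplex E :=
  SRComplex.ofIdeal (G.cutIdeal k q)

/-- The complex `Σ_G^q` is indeed the one with Stanley–Reisner ideal `𝒞_G^q`. -/
theorem DirectedMultigraph.srIdeal_cutComplex {V E : Type*} (G : DirectedMultigraph V E)
    [Fintype E] [DecidableEq V] (k : Type*) [Field k] (q : V) :
    (G.cutComplex k q).srIdeal k = G.cutIdeal k q := by
  apply le_antisymm
  · refine Ideal.span_le.2 ?_
    rintro _ ⟨s, hs, rfl⟩
    exact not_not.1 hs
  · refine Ideal.span_le.2 ?_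
    rintro m ⟨A, h1, h2, h3, rfl⟩
    refine Ideal.subset_span ⟨G.cut A, ?_, rfl⟩
    exact fun h => h (Ideal.subset_span ⟨A, h1, h2, h3, rfl⟩)

/-- A Noetherian local ring is Cohen–Macaulay if its depth equals its dimension, i.e. if its maximal
ideal contains a regular sequence whose length is the Krull dimension. -/
def IsCohenMacaulayLocal (R : Type*) [CommRing R] [IsLocalRing R] : Prop :=
  IsNoetherianRing R ∧ ∃ rs : List R, (∀ r ∈ rs, r ∈ IsLocalRing.maximalIdeal R) ∧
    RingTheory.Sequence.IsRegular R rs ∧ (rs.length : WithBot ℕ∞) = ringKrullDim R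

/-- A Noetherian ring is Cohen–Macaulay if its localizations at all maximal ideals are. -/
def IsCohenMacaulay (R : Type*) [CommRing R] : Prop :=
  IsNoetherianRing R ∧
    ∀ (m : Ideal R) [m.IsMaximal], IsCohenMacaulayLocal (Localization.AtPrime m)

/-- A simplicial complex is Cohen–Macaulay over `k` if its Stanley–Reisner ring is. -/
def SRComplex.IsCohenMacaulay {E : Type*} (K : SRComplex E) (k : Type*) [Field k] : Prop :=
  _root_.IsCohenMacaulay (K.FaceRing k)

end

/-! Combinatorially, a set of edges contains a connected cut away from `q` iff it meets every
oriented spanning tree. A tree reaches all vertices from `q`, so it crosses every cut. Conversely,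
if the remaining edges miss some vertex, a component of the unreached part gives a connected cut
that they avoid. This duality (`exists_connectedCuts_subset_iff`) makes the cut ideal the
intersection of the `P_T`. All trees have n-1 edges, so none contains another; facets, minimal
primes and purity follow.

For Cohen–Macaulayness, fix a tree T₀. Let A be the polynomial ring on the edges outside T₀, mapped
to S by sending the variable of e to y_e - y_f, where f in T₀ has the same head as e (to y_e if that
head is `q`). This one system of linear forms works for every tree: A → S/P_T is bijective, because
T also has exactly one edge into each vertex other than `q`.

The cut ideal is then built up by deletion and contraction. For an edge e leaving the root, the
sequence 0 → S/(I : y_e) → S/I → S/(I + (y_e)) → 0 has the deletion of e on the left and its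
contraction on the right. The induction ends at quotients S/P_T or at zero, so S/I is finite
projective over A (`finite_projective_quotient_minorFamily`). A nonzero ring that is finite and flat
over a polynomial ring is Cohen–Macaulay, of dimension the number of variables, here |E| - n + 1. -/

noncomputable section

/-! ### Regular sequences in maximal ideals of polynomial rings. -/

/-- A monic polynomial is a nonzerodivisor modulo the extension of any ideal of coefficients. -/
theorem Polynomial.Monic.isSMulRegular_quotient {A : Type*} [CommRing A] {f : Polynomial A}
    (hf : f.Monic) (I : Ideal A) :
    IsSMulRegular (Polynomial A ⧸ I.map (Polynomial.C : A →+* Polynomial A)) f := by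
  have key : ∀ g : Polynomial A,
      g ∈ I.map (Polynomial.C : A →+* Polynomial A) ↔ g.map (Ideal.Quotient.mk I) = 0 := by
    intro g
    rw [Ideal.mem_map_C_iff, Polynomial.ext_iff]
    simp [Ideal.Quotient.eq_zero_iff_mem]
  refine IsSMulRegular.of_right_eq_zero_of_smul fun x hx => ?_
  obtain ⟨g, rfl⟩ := Ideal.Quotient.mk_surjective x
  rw [← Ideal.Quotient.mk_eq_mk, ← Submodule.Quotient.mk_smul, Ideal.Quotient.mk_eq_mk,
    Ideal.Quotient.eq_zero_iff_mem, key, smul_eq_mul, Polynomial.map_mul] at hx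
  rw [Ideal.Quotient.eq_zero_iff_mem, key]
  exact ((hf.map (Ideal.Quotient.mk I)).mem_nonZeroDivisors).1 _ hx

theorem RingTheory.Sequence.IsWeaklyRegular.map_ringEquiv {R S : Type*} [CommRing R] [CommRing S]
    (e : R ≃+* S) {rs : List R} (h : IsWeaklyRegular R rs) : IsWeaklyRegular S (rs.map e) := by
  refine (AddEquiv.isWeaklyRegular_congr (e := e.toAddEquiv) ?_).1 h
  exact List.forall₂_map_right_iff.2 (List.forall₂_same.2 fun r _ x => by simp)

/-- A maximal ideal of a polynomial ring in `n` variables over a field contains a weakly regular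
sequence of length `n`. -/
theorem MvPolynomial.exists_isWeaklyRegular_fin (k : Type*) [Field k] (n : ℕ)
    (m : Ideal (MvPolynomial (Fin n) k)) [hm : m.IsMaximal] :
    ∃ rs : List (MvPolynomial (Fin n) k), (∀ r ∈ rs, r ∈ m) ∧
      RingTheory.Sequence.IsWeaklyRegular (MvPolynomial (Fin n) k) rs ∧ rs.length = n := by
  induction n with
  | zero => exact ⟨[], by simp, by simp, rfl⟩
  | succ n ih =>
    let e := (MvPolynomial.finSuccEquiv k n).toRingEquiv
    let P : Ideal (Polynomial (MvPolynomial (Fin n) k)) := m.comap e.symm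
    have hP : P.IsMaximal := Ideal.comap_isMaximal_of_equiv e.symm
    let p := P.comap (Polynomial.C : MvPolynomial (Fin n) k →+* Polynomial (MvPolynomial (Fin n) k))
    have hp : p.IsMaximal := Polynomial.isMaximal_comap_C_of_isJacobsonRing P
    obtain ⟨rs, h1, h2, h3⟩ := ih p
    -- Over a Jacobson base, the residue field at P is integral over the coefficients. A monic
    -- equation for the class of X is a monic element of P, the last term of the sequence.
    obtain ⟨f, hf, hf0⟩ := Polynomial.quotient_mk_comp_C_isIntegral_of_isJacobsonRing P
      (Ideal.Quotient.mk P Polynomial.X)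
    have hfP : f ∈ P := by
      rw [← Ideal.Quotient.eq_zero_iff_mem, ← hf0]
      conv_lhs => rw [← Polynomial.eval₂_C_X (p := f)]
      rw [Polynomial.hom_eval₂]
    have h4 : RingTheory.Sequence.IsWeaklyRegular (Polynomial (MvPolynomial (Fin n) k))
        (rs.map Polynomial.C ++ [f]) := by
      rw [RingTheory.Sequence.isWeaklyRegular_append_iff]
      refine ⟨h2.of_flat, ?_⟩
      rw [RingTheory.Sequence.isWeaklyRegular_singleton_iff]
      have h5 : (Ideal.ofList (rs.map Polynomial.C) • ⊤ :
          Ideal (Polynomial (MvPolynomial (Fin n) k))) = (Ideal.ofList rs).map Polynomial.C := by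
        simp [Ideal.map_ofList]
      rw [h5]
      exact hf.isSMulRegular_quotient _
    refine ⟨(rs.map Polynomial.C ++ [f]).map e.symm, ?_, h4.map_ringEquiv e.symm, by simp [h3]⟩
    intro r hr
    simp only [List.map_append, List.mem_append, List.mem_map, List.mem_singleton] at hr
    rcases hr with ⟨_, ⟨a, ha, rfl⟩, rfl⟩ | ⟨_, rfl, rfl⟩
    · exact h1 a ha
    · exact hfP

theorem MvPolynomial.exists_isWeaklyRegular {σ : Type*} [Fintype σ] (k : Type*) [Field k]
    (m : Ideal (MvPolynomial σ k)) [hm : m.IsMaximal] :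
    ∃ rs : List (MvPolynomial σ k), (∀ r ∈ rs, r ∈ m) ∧
      RingTheory.Sequence.IsWeaklyRegular (MvPolynomial σ k) rs ∧ rs.length = Fintype.card σ := by
  let e := (MvPolynomial.renameEquiv k (Fintype.equivFin σ)).toRingEquiv
  have : (m.comap e.symm).IsMaximal := Ideal.comap_isMaximal_of_equiv e.symm
  obtain ⟨rs, h1, h2, h3⟩ := MvPolynomial.exists_isWeaklyRegular_fin k _ (m.comap e.symm)
  refine ⟨rs.map e.symm, ?_, h2.map_ringEquiv e.symm, by simp [h3]⟩
  intro r hr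
  obtain ⟨a, ha, rfl⟩ := List.mem_map.1 hr
  exact h1 a ha

/-- Incomparability: strict inclusions of primes stay strict after contraction along an integral
map. -/
theorem ringKrullDim_le_of_isIntegral (A R : Type*) [CommRing A] [CommRing R] [Algebra A R]
    [Algebra.IsIntegral A R] : ringKrullDim R ≤ ringKrullDim A := by
  refine Order.krullDim_le_of_strictMono (PrimeSpectrum.comap (algebraMap A R)) ?_
  intro p p' h
  exact Ideal.IsIntegral.comap_lt_comap (R := A) ((PrimeSpectrum.asIdeal_lt_asIdeal _ _).2 h)

theorem ringKrullDim_localization_atPrime_le {R : Type*} [CommRing R] (p : Ideal R) [p.IsPrime] :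
    ringKrullDim (Localization.AtPrime p) ≤ ringKrullDim R := by
  rw [IsLocalization.AtPrime.ringKrullDim_eq_height p]
  exact Ideal.height_le_ringKrullDim_of_ne_top Ideal.IsPrime.ne_top'

/-! ### Rings finite and flat over a polynomial ring. -/

section FiniteFlat

variable {σ : Type*} [Fintype σ] {k : Type*} [Field k] {R : Type*} [CommRing R]

theorem ringKrullDim_le_card_of_finite_mvPolynomial [Algebra (MvPolynomial σ k) R]
    [Module.Finite (MvPolynomial σ k) R] : ringKrullDim R ≤ Fintype.card σ := by
  refine (ringKrullDim_le_of_isIntegral (MvPolynomial σ k) R).trans ?_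
  rw [MvPolynomial.ringKrullDim_of_isNoetherianRing]
  simp

/-- Over a ring that is finite and flat over a polynomial ring, every localization at a maximal
ideal has a regular sequence of length the number of variables. -/
theorem exists_isRegular_localization_of_flat [Algebra (MvPolynomial σ k) R]
    [Module.Finite (MvPolynomial σ k) R] [Module.Flat (MvPolynomial σ k) R]
    (m : Ideal R) [m.IsMaximal] :
    ∃ rs : List (Localization.AtPrime m),
      (∀ r ∈ rs, r ∈ IsLocalRing.maximalIdeal (Localization.AtPrime m)) ∧
      RingTheory.Sequence.IsRegular (Localization.AtPrime m) rs ∧ rs.length = Fintype.card σ := by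
  -- Integrality makes the contraction of m maximal. A weakly regular sequence in it stays weakly
  -- regular under the flat base change, and becomes regular in the localization because it lies in
  -- m.
  have : (m.comap (algebraMap (MvPolynomial σ k) R)).IsMaximal :=
    Ideal.isMaximal_comap_of_isIntegral_of_isMaximal m
  obtain ⟨rs, h1, h2, h3⟩ := MvPolynomial.exists_isWeaklyRegular k
    (m.comap (algebraMap (MvPolynomial σ k) R))
  have h4 : ∀ r ∈ rs.map (algebraMap (MvPolynomial σ k) R), r ∈ m := by
    intro r hr
    obtain ⟨a, ha, rfl⟩ := List.mem_map.1 hr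
    exact h1 a ha
  refine ⟨(rs.map (algebraMap (MvPolynomial σ k) R)).map (algebraMap R _), ?_,
    (h2.of_flat (S := R)).isRegular_of_isLocalization_of_mem (Localization.AtPrime m) m h4,
    by simp [h3]⟩
  intro r hr
  obtain ⟨a, ha, rfl⟩ := List.mem_map.1 hr
  exact (IsLocalization.AtPrime.to_map_mem_maximal_iff (Localization.AtPrime m) m a).2 (h4 a ha)

/-- Each term of a regular sequence lowers the dimension by one, and the final quotient is nonzero,
hence of dimension at least 0. -/
theorem card_le_ringKrullDim_localization_of_flat [Algebra (MvPolynomial σ k) R]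
    [Module.Finite (MvPolynomial σ k) R] [Module.Flat (MvPolynomial σ k) R]
    (m : Ideal R) [m.IsMaximal] :
    (Fintype.card σ : WithBot ℕ∞) ≤ ringKrullDim (Localization.AtPrime m) := by
  have : IsNoetherianRing R := isNoetherian_of_tower (MvPolynomial σ k) inferInstance
  obtain ⟨rs, -, h2, h3⟩ := exists_isRegular_localization_of_flat (σ := σ) (k := k) m
  rw [← ringKrullDim_add_length_eq_ringKrullDim_of_isRegular rs h2, h3]
  have : Nontrivial (Localization.AtPrime m ⧸ Ideal.ofList rs) := by
    refine Ideal.Quotient.nontrivial_iff.2 fun h => h2.top_ne_smul ?_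
    rw [h]; simp
  exact le_add_of_nonneg_left ringKrullDim_nonneg_of_nontrivial

/-- With d variables, d ≤ dim R_m ≤ dim R ≤ d, so the regular sequence of length d has the required
length. -/
theorem isCohenMacaulay_of_finite_flat_mvPolynomial [Algebra (MvPolynomial σ k) R]
    [Module.Finite (MvPolynomial σ k) R] [Module.Flat (MvPolynomial σ k) R] :
    IsCohenMacaulay R := by
  have hR : IsNoetherianRing R := isNoetherian_of_tower (MvPolynomial σ k) inferInstance
  refine ⟨hR, fun m _ => ⟨inferInstance, ?_⟩⟩
  obtain ⟨rs, h1, h2, h3⟩ := exists_isRegular_localization_of_flat (σ := σ) (k := k) m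
  refine ⟨rs, h1, h2, ?_⟩
  rw [h3]
  exact le_antisymm (card_le_ringKrullDim_localization_of_flat (k := k) m)
    ((ringKrullDim_localization_atPrime_le m).trans
      (ringKrullDim_le_card_of_finite_mvPolynomial (k := k)))

theorem ringKrullDim_eq_card_of_finite_flat_mvPolynomial [Algebra (MvPolynomial σ k) R]
    [Module.Finite (MvPolynomial σ k) R] [Module.Flat (MvPolynomial σ k) R]
    [Nontrivial R] : ringKrullDim R = Fintype.card σ := by
  obtain ⟨m, hm⟩ := Ideal.exists_maximal R
  exact le_antisymm (ringKrullDim_le_card_of_finite_mvPolynomial (k := k))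
    ((card_le_ringKrullDim_localization_of_flat (k := k) m).trans
      (ringKrullDim_localization_atPrime_le m))

end FiniteFlat

/-! ### Projectivity along short exact sequences. -/

theorem Module.Projective.of_exact {A M N P : Type*} [CommRing A] [AddCommGroup M] [AddCommGroup N]
    [AddCommGroup P] [Module A M] [Module A N] [Module A P] {f : M →ₗ[A] N} {g : N →ₗ[A] P}
    (h : Function.Exact f g) (hf : Function.Injective f) (hg : Function.Surjective g)
    [Module.Projective A M] [Module.Projective A P] : Module.Projective A N := by
  obtain ⟨l, hl⟩ := Module.projective_lifting_property g LinearMap.id hg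
  exact Module.Projective.of_equiv (h.splitSurjectiveEquiv hf ⟨l, hl⟩).1.symm

/-- Finite projectivity of `S ⧸ I` from the exact sequence
`0 → S ⧸ (I : y) → S ⧸ I → S ⧸ (I + (y)) → 0`. -/
theorem finite_projective_quotient_of_colon {A S : Type*} [CommRing A] [CommRing S] [Algebra A S]
    (I J K : Ideal S) (y : S) (hJ : ∀ f, y * f ∈ I ↔ f ∈ J) (hK : K = I ⊔ Ideal.span {y})
    (h1 : Module.Finite A (S ⧸ J) ∧ Module.Projective A (S ⧸ J))
    (h2 : Module.Finite A (S ⧸ K) ∧ Module.Projective A (S ⧸ K)) :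
    Module.Finite A (S ⧸ I) ∧ Module.Projective A (S ⧸ I) := by
  obtain ⟨_, _⟩ := h1
  obtain ⟨_, _⟩ := h2
  let f : (S ⧸ J) →ₗ[S] (S ⧸ I) := Submodule.mapQ J I (LinearMap.mulLeft S y)
    fun x hx => (hJ x).2 hx
  let g : (S ⧸ I) →ₗ[S] (S ⧸ K) := Submodule.mapQ I K LinearMap.id
    fun x hx => hK ▸ Ideal.mem_sup_left hx
  have hfm : ∀ x : S, f (Submodule.Quotient.mk x) = Submodule.Quotient.mk (y * x) := fun _ => rfl
  have hgm : ∀ x : S, g (Submodule.Quotient.mk x) = Submodule.Quotient.mk x := fun _ => rfl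
  have hf : Function.Injective f := by
    refine (injective_iff_map_eq_zero f).2 fun x hx => ?_
    obtain ⟨x, rfl⟩ := Submodule.Quotient.mk_surjective _ x
    rw [hfm, Submodule.Quotient.mk_eq_zero] at hx
    exact (Submodule.Quotient.mk_eq_zero _).2 ((hJ x).1 hx)
  have hg : Function.Surjective g := by
    intro x
    obtain ⟨x, rfl⟩ := Submodule.Quotient.mk_surjective _ x
    exact ⟨Submodule.Quotient.mk x, rfl⟩
  have hfg : Function.Exact f g := by
    intro x
    obtain ⟨x, rfl⟩ := Submodule.Quotient.mk_surjective _ x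
    rw [hgm, Submodule.Quotient.mk_eq_zero, hK]
    constructor
    · intro hx
      obtain ⟨i, hi, z, hz, rfl⟩ := Submodule.mem_sup.1 hx
      obtain ⟨z, rfl⟩ := Ideal.mem_span_singleton'.1 hz
      refine ⟨Submodule.Quotient.mk z, ?_⟩
      rw [hfm, Submodule.Quotient.eq]
      convert I.neg_mem hi using 1
      ring
    · rintro ⟨z, hz⟩
      obtain ⟨z, rfl⟩ := Submodule.Quotient.mk_surjective _ z
      rw [hfm, Submodule.Quotient.eq] at hz
      refine Submodule.mem_sup.2 ⟨-(y * z - x), I.neg_mem hz, y * z,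
        Ideal.mul_mem_right _ _ (Ideal.mem_span_singleton_self y), by ring⟩
  let fA := f.restrictScalars A
  let gA := g.restrictScalars A
  exact ⟨Module.Finite.of_exact (f := fA) (g := gA) hfg hg,
    Module.Projective.of_exact (f := fA) (g := gA) hfg hf hg⟩

/-! ### Squarefree monomial ideals -/

/-- The ideal generated by the squarefree monomials `∏ e ∈ F, X e` for `F ∈ 𝓕`. -/
def sqfreeIdeal {E : Type*} (k : Type*) [Field k] (𝓕 : Set (Finset E)) : Ideal (MvPolynomial E k) :=
  Ideal.span ((fun F : Finset E => ∏ e ∈ F, MvPolynomial.X e) '' 𝓕)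

section SqfreeIdeal

variable {E : Type*} (k : Type*) [Field k]

/-- Membership in a monomial ideal is tested on each monomial separately, and a squarefree monomial
divides m iff its variables lie in the support of m. -/
theorem mem_sqfreeIdeal {𝓕 : Set (Finset E)} {f : MvPolynomial E k} :
    f ∈ sqfreeIdeal k 𝓕 ↔ ∀ m ∈ f.support, ∃ F ∈ 𝓕, F ⊆ m.support := by
  classical
  have h1 : ∀ F : Finset E, (∏ e ∈ F, MvPolynomial.X e : MvPolynomial E k) =
      MvPolynomial.monomial (∑ e ∈ F, Finsupp.single e 1) 1 := by
    intro F
    rw [MvPolynomial.monomial_sum_one]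
    rfl
  have h2 : ∀ (F : Finset E) (e : E), (∑ i ∈ F, Finsupp.single i 1 : E →₀ ℕ) e =
      if e ∈ F then 1 else 0 := by
    intro F e
    simp [Finsupp.finsetSum_apply, Finsupp.single_apply]
  have h3 : sqfreeIdeal k 𝓕 = Ideal.span ((fun s => MvPolynomial.monomial s (1 : k)) ''
      ((fun F : Finset E => ∑ e ∈ F, Finsupp.single e 1) '' 𝓕)) := by
    rw [sqfreeIdeal, Set.image_image]
    simp_rw [h1]
  rw [h3, MvPolynomial.mem_ideal_span_monomial_image]
  simp only [Set.exists_mem_image]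
  refine forall₂_congr fun m _ => exists_congr fun F => and_congr_right fun _ => ?_
  rw [Finsupp.le_def]
  refine forall_congr' fun e => ?_
  rw [h2, Finsupp.mem_support_iff]
  split_ifs with h <;> simp [h, Nat.one_le_iff_ne_zero]

/-- This computes the colon ideal by y_e: F ⊆ {e} ∪ supp m iff F \ {e} ⊆ supp m. -/
theorem X_mul_mem_sqfreeIdeal [DecidableEq E] {𝓕 : Set (Finset E)} {f : MvPolynomial E k} {e : E} :
    MvPolynomial.X e * f ∈ sqfreeIdeal k 𝓕 ↔ f ∈ sqfreeIdeal k ((fun F => F.erase e) '' 𝓕) := by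
  simp only [mem_sqfreeIdeal, MvPolynomial.support_X_mul, Finset.mem_map, Set.exists_mem_image,
    forall_exists_index, and_imp, forall_apply_eq_imp_iff₂, addLeftEmbedding_apply]
  refine forall₂_congr fun m _ => exists_congr fun F => and_congr_right fun _ => ?_
  have : (Finsupp.single e 1 + m).support = insert e m.support := by
    ext x
    simp [Finsupp.single_apply]
    tauto
  rw [this, Finset.subset_insert_iff]

theorem sqfreeIdeal_le {𝓕 𝓖 : Set (Finset E)} (h : ∀ F ∈ 𝓕, ∃ G ∈ 𝓖, G ⊆ F) :
    sqfreeIdeal k 𝓕 ≤ sqfreeIdeal k 𝓖 := by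
  intro f hf
  rw [mem_sqfreeIdeal] at hf ⊢
  intro m hm
  obtain ⟨F, hF, hFm⟩ := hf m hm
  obtain ⟨G, hG, hGF⟩ := h F hF
  exact ⟨G, hG, hGF.trans hFm⟩

theorem sqfreeIdeal_union_singleton (𝓕 : Set (Finset E)) (e : E) :
    sqfreeIdeal k (𝓕 ∪ {{e}}) = sqfreeIdeal k 𝓕 ⊔ Ideal.span {MvPolynomial.X e} := by
  rw [sqfreeIdeal, sqfreeIdeal, Set.image_union, Ideal.span_union]
  simp

theorem prod_X_mem_sqfreeIdeal {𝓕 : Set (Finset E)} {s : Finset E} :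
    (∏ e ∈ s, MvPolynomial.X e : MvPolynomial E k) ∈ sqfreeIdeal k 𝓕 ↔ ∃ F ∈ 𝓕, F ⊆ s := by
  classical
  constructor
  · have h1 : (∏ e ∈ s, MvPolynomial.X e : MvPolynomial E k) =
        MvPolynomial.monomial (∑ e ∈ s, Finsupp.single e 1) 1 := by
      rw [MvPolynomial.monomial_sum_one]
      rfl
    intro h
    obtain ⟨F, hF, hFs⟩ := (mem_sqfreeIdeal k).1 h (∑ e ∈ s, Finsupp.single e 1) (by
      rw [h1, MvPolynomial.support_monomial, if_neg one_ne_zero, Finset.mem_singleton])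
    refine ⟨F, hF, fun e he => ?_⟩
    have := hFs he
    by_contra hes
    simp [Finsupp.finsetSum_apply, Finsupp.single_apply, hes] at this
  · rintro ⟨F, hF, hFs⟩
    exact Ideal.mem_of_dvd _ (Finset.prod_dvd_prod_of_subset _ _ _ hFs)
      (Ideal.subset_span ⟨F, hF, rfl⟩)

theorem treeIdeal_eq_sqfreeIdeal (T : Finset E) :
    DirectedMultigraph.treeIdeal k T = sqfreeIdeal k {F | ∃ e ∈ T, F = {e}} := by
  rw [DirectedMultigraph.treeIdeal, sqfreeIdeal]
  congr 1
  ext f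
  constructor
  · rintro ⟨e, he, rfl⟩
    exact ⟨{e}, ⟨e, he, rfl⟩, by simp⟩
  · rintro ⟨_, ⟨e, he, rfl⟩, rfl⟩
    exact ⟨e, he, by simp⟩

end SqfreeIdeal

/-! ### Transversals and the linear system of parameters -/

namespace DirectedMultigraph

variable {V E : Type*} [DecidableEq V] (G : DirectedMultigraph V E)

/-- Every vertex of `U` other than `q` is the head of exactly one edge of `T`, and no other vertex
is the head of an edge of `T`. -/
def IsTransversal (q : V) (U : Set V) (T : Finset E) : Prop :=
  ∀ v, (v ∈ U ∧ v ≠ q → ∃ e, T.filter (fun e => G.head e = v) = {e}) ∧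
    (¬ (v ∈ U ∧ v ≠ q) → T.filter (fun e => G.head e = v) = ∅)

variable {G}

theorem IsTransversal.sum_head {q : V} {T : Finset E} (hT : G.IsTransversal q Set.univ T)
    {M : Type*} [AddCommMonoid M] (f : E → M) {e : E} (he : e ∈ T) :
    ∑ e' ∈ T with G.head e' = G.head e, f e' = f e := by
  have hmem : e ∈ T.filter (fun e' => G.head e' = G.head e) := by simp [he]
  by_cases hv : G.head e = q
  · rw [(hT _).2 (by simp [hv])] at hmem
    simp at hmem
  · obtain ⟨e', h⟩ := (hT (G.head e)).1 ⟨Set.mem_univ _, hv⟩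
    rw [h, Finset.mem_singleton] at hmem
    rw [h, hmem, Finset.sum_singleton]

/-- Passing to the edge of T with the same head does not change the head; this produces the
cancellations in both composites of `paramHom` and `paramRetract`. -/
theorem IsTransversal.sum_const {q : V} {T T' : Finset E} (hT : G.IsTransversal q Set.univ T)
    (hT' : G.IsTransversal q Set.univ T') {M : Type*} [AddCommMonoid M] (f : E → M) (v : V) :
    ∑ e ∈ T with G.head e = v, ∑ e' ∈ T' with G.head e' = G.head e, f e' =
      ∑ e' ∈ T' with G.head e' = v, f e' := by
  by_cases hv : v = q
  · rw [(hT _).2 (by simp [hv]), (hT' _).2 (by simp [hv])]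
    simp
  · obtain ⟨e, h⟩ := (hT v).1 ⟨Set.mem_univ _, hv⟩
    have : e ∈ T.filter (fun e' => G.head e' = v) := by simp [h]
    rw [h, Finset.sum_singleton, (Finset.mem_filter.1 this).2]

theorem mem_cut [Fintype E] {A : Finset V} {e : E} : e ∈ G.cut A ↔ G.head e ∈ A ∧ G.tail e ∉ A := by
  simp [cut]

theorem IsTransversal.head_mem {U : Set V} {W : Finset E} {e : E}
    (hW : G.IsTransversal q U W) (he : e ∈ W) : G.head e ∈ U ∧ G.head e ≠ q := by
  by_contra h
  have : e ∈ W.filter (fun e' => G.head e' = G.head e) := by simp [he]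
  simp [(hW _).2 h] at this

variable (G) [DecidableEq E] (k : Type*) [Field k]

/-- The linear forms `y_e - y_f`, where `f` is the edge of `T₀` with the same head as `e`
(and `y_e` if the head of `e` is the root), as an algebra map from a polynomial ring. -/
def paramHom (T₀ : Finset E) : MvPolynomial {e // e ∉ T₀} k →ₐ[k] MvPolynomial E k :=
  MvPolynomial.aeval fun e => MvPolynomial.X e.1 -
    ∑ e' ∈ T₀ with G.head e' = G.head e.1, MvPolynomial.X e'

/-- The variables outside `T₀`, extended by zero to `T₀`. -/
def coParam (T₀ : Finset E) (e : E) : MvPolynomial {e // e ∉ T₀} k :=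
  if h : e ∈ T₀ then 0 else MvPolynomial.X ⟨e, h⟩

/-- The retraction of `paramHom` which kills the variables of the transversal `T`. -/
def paramRetract (T₀ T : Finset E) : MvPolynomial E k →ₐ[k] MvPolynomial {e // e ∉ T₀} k :=
  MvPolynomial.aeval fun e => coParam k T₀ e - ∑ e' ∈ T with G.head e' = G.head e, coParam k T₀ e'

variable {G} {q : V} {T₀ T : Finset E}

theorem paramHom_coParam (h₀ : G.IsTransversal q Set.univ T₀) (e : E) :
    G.paramHom k T₀ (coParam k T₀ e) = MvPolynomial.X e -
      ∑ e' ∈ T₀ with G.head e' = G.head e, MvPolynomial.X e' := by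
  unfold coParam
  split_ifs with h
  · rw [map_zero, h₀.sum_head _ h, sub_self]
  · simp [paramHom]

/-- Write z for the parameters, f and t for the edges of T₀ and T with the head of e. The composite
sends z_e to (z_e - z_t) - (z_f - z_t), and z_f = 0. -/
theorem paramRetract_paramHom (h₀ : G.IsTransversal q Set.univ T₀)
    (h : G.IsTransversal q Set.univ T) (a : MvPolynomial {e // e ∉ T₀} k) :
    G.paramRetract k T₀ T (G.paramHom k T₀ a) = a := by
  suffices (G.paramRetract k T₀ T).comp (G.paramHom k T₀) = AlgHom.id k _ from
    DFunLike.congr_fun this a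
  refine MvPolynomial.algHom_ext fun ⟨e, he⟩ => ?_
  have h1 : ∀ x ∈ T₀, coParam k T₀ x = 0 := fun x hx => by simp [coParam, hx]
  have h2 : ∑ x ∈ T₀ with G.head x = G.head e, coParam k T₀ x = 0 :=
    Finset.sum_eq_zero fun x hx => h1 x (Finset.mem_filter.1 hx).1
  have h3 : coParam k T₀ e = MvPolynomial.X ⟨e, he⟩ := by simp [coParam, he]
  simp only [AlgHom.comp_apply, paramHom, paramRetract, MvPolynomial.aeval_X, map_sub, map_sum,
    Finset.sum_sub_distrib, h₀.sum_const h, h2, h3, AlgHom.id_apply]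
  ring

/-- The composite sends y_e to (y_e - y_f) - (y_t - y_f) = y_e - y_t, with f in T₀ and t in T;
modulo P_T the term y_t vanishes. -/
theorem paramHom_paramRetract (h₀ : G.IsTransversal q Set.univ T₀)
    (h : G.IsTransversal q Set.univ T) (f : MvPolynomial E k) :
    Ideal.Quotient.mkₐ k (treeIdeal k T) (G.paramHom k T₀ (G.paramRetract k T₀ T f)) =
      Ideal.Quotient.mkₐ k (treeIdeal k T) f := by
  suffices ((Ideal.Quotient.mkₐ k (treeIdeal k T)).comp (G.paramHom k T₀)).comp
      (G.paramRetract k T₀ T) = Ideal.Quotient.mkₐ k (treeIdeal k T) from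
    DFunLike.congr_fun this f
  refine MvPolynomial.algHom_ext fun e => ?_
  have h1 : ∑ x ∈ T with G.head x = G.head e,
      Ideal.Quotient.mkₐ k (treeIdeal k T) (MvPolynomial.X x) = 0 := by
    refine Finset.sum_eq_zero fun x hx => ?_
    exact Ideal.Quotient.eq_zero_iff_mem.2 (Ideal.subset_span ⟨x, (Finset.mem_filter.1 hx).1, rfl⟩)
  simp only [AlgHom.comp_apply, paramRetract, MvPolynomial.aeval_X, map_sub, map_sum,
    paramHom_coParam k h₀, Finset.sum_sub_distrib, h.sum_const h₀, h1]
  ring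

theorem paramRetract_mem (h : G.IsTransversal q Set.univ T) {f : MvPolynomial E k}
    (hf : f ∈ treeIdeal k T) : G.paramRetract k T₀ T f = 0 := by
  have : treeIdeal k T ≤ RingHom.ker (G.paramRetract k T₀ T) := by
    refine Ideal.span_le.2 ?_
    rintro _ ⟨e, he, rfl⟩
    simp [paramRetract, h.sum_head _ he]
  exact this hf

theorem bijective_mk_paramHom (h₀ : G.IsTransversal q Set.univ T₀)
    (h : G.IsTransversal q Set.univ T) :
    Function.Bijective fun a => Ideal.Quotient.mk (treeIdeal k T) (G.paramHom k T₀ a) := by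
  constructor
  · intro a b hab
    have := paramRetract_mem k (T₀ := T₀) h (Ideal.Quotient.eq.1 hab)
    rwa [map_sub, paramRetract_paramHom k h₀ h, paramRetract_paramHom k h₀ h, sub_eq_zero] at this
  · intro x
    obtain ⟨f, rfl⟩ := Ideal.Quotient.mk_surjective x
    exact ⟨_, paramHom_paramRetract k h₀ h f⟩

theorem IsTransversal.isPrime_treeIdeal (h : G.IsTransversal q Set.univ T) :
    (treeIdeal k T).IsPrime := by
  rw [← Ideal.Quotient.isDomain_iff_prime]
  have hb := bijective_mk_paramHom k h h
  exact MulEquiv.isDomain _ (RingEquiv.ofBijective ((Ideal.Quotient.mk (treeIdeal k T)).comp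
    (G.paramHom k T : MvPolynomial {e // e ∉ T} k →+* MvPolynomial E k)) hb).symm.toMulEquiv

/-! ### Deletion and contraction -/

/-- The generators of the ideal obtained from the ideal of all cuts after contracting `U` to the
root along the edges of `W` and deleting the edges outside `D`. -/
def minorFamily [Fintype E] (G : DirectedMultigraph V E) (U : Finset V) (W D : Finset E) :
    Set (Finset E) :=
  {F | (∃ e ∈ W, F = {e}) ∨ ∃ B : Finset V, B.Nonempty ∧ Disjoint B U ∧ F = G.cut B ∩ D}

theorem IsTransversal.insert {U : Finset V} {W : Finset E} {e : E}
    (hW : G.IsTransversal q (U : Set V) W) (hq : q ∈ U) (he : G.head e ∉ U) :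
    G.IsTransversal q ((Insert.insert (G.head e) U : Finset V) : Set V) (Insert.insert e W) := by
  intro v
  have hv := hW v
  rw [Finset.filter_insert]
  by_cases hev : G.head e = v
  · subst hev
    have hvq : G.head e ≠ q := fun h => he (h ▸ hq)
    have := hv.2 (fun h => he h.1)
    simp [this, hvq]
  · have : v ∈ ((Insert.insert (G.head e) U : Finset V) : Set V) ↔ v ∈ (U : Set V) := by
      simp [Ne.symm hev]
    rw [if_neg hev, this]
    exact hv

section Minor

variable [Fintype E]

theorem erase_minorFamily {U : Finset V} {W D : Finset E} {e : E} (heW : e ∉ W) :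
    (fun F => F.erase e) '' G.minorFamily U W D = G.minorFamily U W (D.erase e) := by
  have h1 : ∀ w ∈ W, ({w} : Finset E).erase e = {w} := fun w hw =>
    Finset.erase_eq_of_notMem fun h => heW (Finset.mem_singleton.1 h ▸ hw)
  ext F
  constructor
  · rintro ⟨_, ⟨w, hw, rfl⟩ | ⟨B, hB, hBU, rfl⟩, rfl⟩
    · exact Or.inl ⟨w, hw, h1 w hw⟩
    · exact Or.inr ⟨B, hB, hBU, (Finset.inter_erase _ _ _).symm⟩
  · rintro (⟨w, hw, rfl⟩ | ⟨B, hB, hBU, rfl⟩)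
    · exact ⟨{w}, Or.inl ⟨w, hw, rfl⟩, h1 w hw⟩
    · exact ⟨_, Or.inr ⟨B, hB, hBU, rfl⟩, (Finset.inter_erase _ _ _).symm⟩

/-- A cut around the head of e contains e, since the tail lies in U, and is absorbed by y_e. A cut
avoiding the head does not contain e, so deleting e leaves it unchanged. -/
theorem sqfreeIdeal_minorFamily_insert {U : Finset V} {W D : Finset E} {e : E} (heD : e ∈ D)
    (het : G.tail e ∈ U) :
    sqfreeIdeal k (G.minorFamily (insert (G.head e) U) (insert e W) (D.erase e)) =
      sqfreeIdeal k (G.minorFamily U W D) ⊔ Ideal.span {MvPolynomial.X e} := by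
  rw [← sqfreeIdeal_union_singleton]
  have h1 : ∀ B : Finset V, G.head e ∉ B → G.cut B ∩ D = G.cut B ∩ D.erase e := by
    intro B hB
    rw [Finset.inter_erase, Finset.erase_eq_of_notMem]
    simp [mem_cut, hB]
  refine le_antisymm (sqfreeIdeal_le k ?_) (sqfreeIdeal_le k ?_)
  · rintro F (⟨w, hw, rfl⟩ | ⟨B, hB, hBU, rfl⟩)
    · rcases Finset.mem_insert.1 hw with rfl | hw
      · exact ⟨_, Or.inr rfl, subset_rfl⟩
      · exact ⟨_, Or.inl (Or.inl ⟨w, hw, rfl⟩), subset_rfl⟩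
    · rw [Finset.disjoint_insert_right] at hBU
      exact ⟨_, Or.inl (Or.inr ⟨B, hB, hBU.2, rfl⟩), (h1 B hBU.1).subset⟩
  · rintro F ((⟨w, hw, rfl⟩ | ⟨B, hB, hBU, rfl⟩) | rfl)
    · exact ⟨_, Or.inl ⟨w, Finset.mem_insert_of_mem hw, rfl⟩, subset_rfl⟩
    · by_cases hv : G.head e ∈ B
      · refine ⟨{e}, Or.inl ⟨e, Finset.mem_insert_self _ _, rfl⟩, ?_⟩
        rw [Finset.singleton_subset_iff, Finset.mem_inter, mem_cut]
        exact ⟨⟨hv, fun h => Finset.disjoint_left.1 hBU h het⟩, heD⟩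
      · exact ⟨_, Or.inr ⟨B, hB, Finset.disjoint_insert_right.2 ⟨hv, hBU⟩, rfl⟩,
          (h1 B hv).symm.subset⟩
    · exact ⟨_, Or.inl ⟨e, Finset.mem_insert_self _ _, rfl⟩, subset_rfl⟩

/-- By deletion and contraction, the quotient by the ideal of a minor is finite projective over
the parameter ring. -/
theorem finite_projective_quotient_minorFamily [Fintype V]
    [Algebra (MvPolynomial {e // e ∉ T₀} k) (MvPolynomial E k)]
    (halg : ∀ a, algebraMap (MvPolynomial {e // e ∉ T₀} k) (MvPolynomial E k) a =
      G.paramHom k T₀ a)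
    (h₀ : G.IsTransversal q Set.univ T₀) (D : Finset E) (U : Finset V) (W : Finset E)
    (hq : q ∈ U) (hW : G.IsTransversal q (U : Set V) W) :
    Module.Finite (MvPolynomial {e // e ∉ T₀} k)
        (MvPolynomial E k ⧸ sqfreeIdeal k (G.minorFamily U W D)) ∧
      Module.Projective (MvPolynomial {e // e ∉ T₀} k)
        (MvPolynomial E k ⧸ sqfreeIdeal k (G.minorFamily U W D)) := by
  induction D using Finset.strongInduction generalizing U W with
  | H D ih =>
  -- Everything is contracted: no cut is left, and W is a full transversal.
  by_cases hU : U = Finset.univ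
  · subst hU
    have hJ : sqfreeIdeal k (G.minorFamily Finset.univ W D) = treeIdeal k W := by
      rw [treeIdeal_eq_sqfreeIdeal]
      congr 1
      ext F
      refine or_iff_left ?_
      rintro ⟨B, hB, hBU, -⟩
      exact hB.ne_empty (disjoint_top.1 hBU)
    rw [hJ]
    rw [Finset.coe_univ] at hW
    let φ := Algebra.linearMap (MvPolynomial {e // e ∉ T₀} k) (MvPolynomial E k ⧸ treeIdeal k W)
    have hφ : Function.Bijective φ := by
      convert bijective_mk_paramHom k h₀ hW using 2 with a
      rw [← halg]
      rfl
    let ψ := LinearEquiv.ofBijective φ hφ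
    exact ⟨Module.Finite.equiv ψ, Module.Projective.of_equiv ψ⟩
  by_cases he : ∃ e ∈ D, G.tail e ∈ U ∧ G.head e ∉ U
  · obtain ⟨e, heD, het, heh⟩ := he
    have heW : e ∉ W := fun h => heh (hW.head_mem h).1
    have hlt := Finset.erase_ssubset heD
    refine finite_projective_quotient_of_colon _ _ _ (MvPolynomial.X e) (fun f => ?_)
      (sqfreeIdeal_minorFamily_insert k heD het)
      (ih _ hlt U W hq hW) (ih _ hlt _ _ (Finset.mem_insert_of_mem hq) (hW.insert hq heh))
    rw [X_mul_mem_sqfreeIdeal, erase_minorFamily heW]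
  -- No edge of D leaves U, so the cut around the complement of U is empty and 1 lies in the ideal.
  · have hJ : sqfreeIdeal k (G.minorFamily U W D) = ⊤ := by
      rw [Ideal.eq_top_iff_one, ← Finset.prod_empty, prod_X_mem_sqfreeIdeal]
      refine ⟨∅, Or.inr ⟨Uᶜ, ?_, disjoint_compl_left, ?_⟩, subset_rfl⟩
      · rwa [Finset.nonempty_iff_ne_empty, Ne, Finset.compl_eq_empty_iff]
      · refine (Finset.eq_empty_of_forall_notMem fun e h => he ⟨e, ?_⟩).symm
        rw [Finset.mem_inter, mem_cut] at h
        exact ⟨h.2, by simpa using h.1.2, by simpa using h.1.1⟩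
    rw [hJ]
    have : Subsingleton (MvPolynomial E k ⧸ (⊤ : Ideal (MvPolynomial E k))) :=
      Ideal.Quotient.subsingleton_iff.2 rfl
    exact ⟨inferInstance, inferInstance⟩

end Minor

end DirectedMultigraph

/-! ### Connected cuts -/

namespace SimpleGraph

variable {V : Type*} {H : SimpleGraph V}

theorem induce_connected_of_reflTransGen {S : Set V} {s₀ : V} (h₀ : s₀ ∈ S)
    (h : ∀ s ∈ S, Relation.ReflTransGen (fun a b => H.Adj a b ∧ a ∈ S ∧ b ∈ S) s s₀) :
    (H.induce S).Connected := by
  have key : ∀ s (hs : s ∈ S), (H.induce S).Reachable ⟨s, hs⟩ ⟨s₀, h₀⟩ := by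
    intro s hs
    have := h s hs
    induction this using Relation.ReflTransGen.head_induction_on with
    | refl => exact Reachable.refl _
    | head hac _ ih =>
      have hadj : (H.induce S).Adj ⟨_, hac.2.1⟩ ⟨_, hac.2.2⟩ := hac.1
      exact hadj.reachable.trans (ih hac.2.2)
  have : Nonempty S := ⟨⟨s₀, h₀⟩⟩
  exact ⟨fun a b => (key a.1 a.2).trans (key b.1 b.2).symm⟩

/-- In a connected graph, a component `A` of the complement of a connected vertex set `R` is
connected, has connected complement, and has no neighbours outside `R ∪ A`. -/
theorem Connected.exists_component_compl (hH : H.Connected) {R : Set V} {q v : V} (hv : v ∉ R)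
    (hq : q ∈ R)
    (hR : ∀ w ∈ R, Relation.ReflTransGen (fun a b => H.Adj a b ∧ a ∈ R ∧ b ∈ R) w q) :
    ∃ A : Set V, (∀ w ∈ A, w ∉ R) ∧ (H.induce A).Connected ∧ (H.induce Aᶜ).Connected ∧
      ∀ a b, H.Adj a b → a ∈ A → b ∉ R → b ∈ A := by
  -- The component of v in the complement of R.
  let A : Set V := {w | Relation.ReflTransGen (fun a b => H.Adj a b ∧ a ∉ R ∧ b ∉ R) w v}
  have hAR : ∀ w ∈ A, w ∉ R := by
    intro w hw
    rcases Relation.ReflTransGen.cases_head hw with rfl | ⟨c, hc, -⟩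
    · exact hv
    · exact hc.2.1
  have hA : ∀ a b, H.Adj a b → a ∈ A → b ∉ R → b ∈ A := fun a b hab ha hb =>
    Relation.ReflTransGen.head ⟨hab.symm, hb, hAR a ha⟩ ha
  refine ⟨A, hAR, ?_, ?_, hA⟩
  · refine induce_connected_of_reflTransGen (s₀ := v) Relation.ReflTransGen.refl fun s hs => ?_
    have hs' : Relation.ReflTransGen (fun a b => H.Adj a b ∧ a ∉ R ∧ b ∉ R) s v := hs
    clear hs
    induction hs' using Relation.ReflTransGen.head_induction_on with
    | refl => exact Relation.ReflTransGen.refl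
    | head hac hc ih =>
      exact Relation.ReflTransGen.head ⟨hac.1, Relation.ReflTransGen.head hac hc, hc⟩ ih
  · refine induce_connected_of_reflTransGen (s₀ := q) (fun h => hAR q h hq) fun s hs => ?_
    -- Follow a path towards q. It stays outside A until it enters R, since A absorbs its neighbours
    -- outside R; from there `hR` leads to q.
    have hreach := (reachable_iff_reflTransGen s q).1 (hH.preconnected s q)
    induction hreach using Relation.ReflTransGen.head_induction_on with
    | refl => exact Relation.ReflTransGen.refl
    | head hac hc ih =>
      rename_i a c
      by_cases ha : a ∈ R
      · exact (hR a ha).lift id fun x y hxy =>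
          ⟨hxy.1, fun h => hAR x h hxy.2.1, fun h => hAR y h hxy.2.2⟩
      · have hcA : c ∉ A := fun h => hs (hA c a hac.symm h ha)
        exact Relation.ReflTransGen.head ⟨hac, hs, hcA⟩ (ih hcA)

end SimpleGraph

namespace DirectedMultigraph

variable {V E : Type*} {G : DirectedMultigraph V E} {q : V}

theorem underlying_adj_of_mem {T : Set E} {e : E} (he : e ∈ T) :
    (G.underlying T).Adj (G.tail e) (G.head e) :=
  (SimpleGraph.fromRel_adj _ _ _).2 ⟨G.loopless e, Or.inl ⟨e, he, rfl, rfl⟩⟩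

/-- If the edges in `F` do not reach every vertex from `q`, they miss a connected cut. -/
theorem IsConnected.exists_connected_cut [Fintype V] [Fintype E] [DecidableEq V]
    (hG : G.IsConnected) {F : Set E} (hF : ¬ ∀ v, Relation.ReflTransGen (G.Step F) q v) :
    ∃ A : Finset V, q ∉ A ∧ G.InducesConnected (A : Set V) ∧
      G.InducesConnected ((A : Set V)ᶜ) ∧ ∀ e ∈ F, e ∉ G.cut A := by
  classical
  push Not at hF
  obtain ⟨v, hv⟩ := hF
  let R : Set V := {w | Relation.ReflTransGen (G.Step F) q w}
  have hR : ∀ w ∈ R, Relation.ReflTransGen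
      (fun a b => (G.underlying Set.univ).Adj a b ∧ a ∈ R ∧ b ∈ R) w q := by
    intro w hw
    have hw' : Relation.ReflTransGen (G.Step F) q w := hw
    clear hw
    induction hw' with
    | refl => exact Relation.ReflTransGen.refl
    | tail hb hbc ih =>
      refine Relation.ReflTransGen.head ⟨?_, hb.tail hbc, hb⟩ ih
      obtain ⟨e, -, rfl, rfl⟩ := hbc
      exact (underlying_adj_of_mem (Set.mem_univ e)).symm
  obtain ⟨A, hAR, h1, h2, h3⟩ := SimpleGraph.Connected.exists_component_compl hG (R := R) hv
    (q := q) Relation.ReflTransGen.refl hR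
  refine ⟨A.toFinset, fun h => hAR q (by simpa using h) Relation.ReflTransGen.refl, ?_, ?_, ?_⟩
  · rwa [Set.coe_toFinset]
  · rwa [Set.coe_toFinset]
  · intro e he hc
    rw [mem_cut, Set.mem_toFinset, Set.mem_toFinset] at hc
    -- An F-edge entering A from R would make its head reachable; a tail outside R would already lie
    -- in A.
    by_cases ht : G.tail e ∈ R
    · exact hAR _ hc.1 (Relation.ReflTransGen.tail ht ⟨e, he, rfl, rfl⟩)
    · exact hc.2 (h3 _ _ (underlying_adj_of_mem (Set.mem_univ e)).symm hc.1 ht)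

theorem exists_mem_cut_of_reaches [Fintype E] [DecidableEq V] {F : Set E}
    (hF : ∀ v, Relation.ReflTransGen (G.Step F) q v) {B : Finset V} (hB : B.Nonempty)
    (hq : q ∉ B) : ∃ e ∈ F, e ∈ G.cut B := by
  obtain ⟨v, hv⟩ := hB
  have h := hF v
  induction h with
  | refl => exact absurd hv hq
  | tail hb hbc ih =>
    obtain ⟨e, he, rfl, rfl⟩ := hbc
    by_cases ht : G.tail e ∈ B
    · exact ih ht
    · exact ⟨e, he, mem_cut.2 ⟨hv, ht⟩⟩

/-! ### Oriented spanning trees -/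

/-- The vertices reached from `q` by a walk of length at most `n` in `F`. -/
def ball (G : DirectedMultigraph V E) (q : V) (F : Set E) : ℕ → Set V
  | 0 => {q}
  | n + 1 => ball G q F n ∪ {v | ∃ e ∈ F, G.tail e ∈ ball G q F n ∧ G.head e = v}

/-- Take d to be the length of a shortest walk from q; its last edge comes from a vertex of smaller
d. -/
theorem exists_dist {F : Set E} (hF : ∀ v, Relation.ReflTransGen (G.Step F) q v) :
    ∃ d : V → ℕ, ∀ v, v ≠ q → ∃ e ∈ F, G.head e = v ∧ d (G.tail e) < d v := by
  classical
  have hex : ∀ v, ∃ n, v ∈ G.ball q F n := by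
    intro v
    induction hF v with
    | refl => exact ⟨0, rfl⟩
    | tail hb hbc ih =>
      obtain ⟨n, hn⟩ := ih
      obtain ⟨e, he, rfl, rfl⟩ := hbc
      exact ⟨n + 1, Or.inr ⟨e, he, hn, rfl⟩⟩
  refine ⟨fun v => Nat.find (hex v), fun v hv => ?_⟩
  have hspec := Nat.find_spec (hex v)
  rcases hn : Nat.find (hex v) with _ | n
  · rw [hn] at hspec
    exact absurd hspec hv
  · rw [hn] at hspec
    rcases hspec with h | ⟨e, he, ht, rfl⟩
    · exact absurd h (Nat.find_min (hex v) (by omega))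
    · exact ⟨e, he, rfl, lt_of_le_of_lt (Nat.find_min' _ ht)
        (hn.symm ▸ Nat.lt_succ_self n : n < Nat.find (hex _))⟩

/-- A breadth-first tree: each vertex other than q keeps one incoming edge along which d increases.
This excludes cycles, and following these edges backwards ends at q. -/
theorem exists_isOrientedSpanningTree_subset [Fintype V] {F : Finset E}
    (hF : ∀ v, Relation.ReflTransGen (G.Step (F : Set E)) q v) :
    ∃ T ⊆ F, G.IsOrientedSpanningTree q T := by
  classical
  obtain ⟨d, hd⟩ := exists_dist hF
  choose p hpF hph hpd using hd
  let T : Finset E := Finset.univ.image fun v : {v // v ≠ q} => p v.1 v.2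
  have hT : ∀ e, e ∈ T ↔ ∃ v, ∃ hv : v ≠ q, p v hv = e := by simp [T]
  have hstep : ∀ a b, G.Step (T : Set E) a b → d a < d b ∧ b ≠ q := by
    rintro a b ⟨e, he, rfl, rfl⟩
    obtain ⟨v, hv, rfl⟩ := (hT e).1 he
    rw [hph]
    exact ⟨hpd v hv, hv⟩
  refine ⟨T, ?_, ?_, ?_, ?_, ?_⟩
  · intro e he
    obtain ⟨v, hv, rfl⟩ := (hT e).1 he
    exact hpF v hv
  · have key : ∀ n v, d v = n → (G.underlying (T : Set E)).Reachable v q := by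
      intro n
      induction n using Nat.strong_induction_on with
      | _ n ih =>
        rintro v rfl
        by_cases hv : v = q
        · rw [hv]
        · have hadj := underlying_adj_of_mem (G := G) (T := (T : Set E))
            (show p v hv ∈ (T : Set E) from (hT _).2 ⟨v, hv, rfl⟩)
          rw [hph] at hadj
          exact hadj.symm.reachable.trans (ih _ (hpd v hv) _ rfl)
    have : Nonempty V := ⟨q⟩
    exact ⟨fun a b => (key _ a rfl).trans (key _ b rfl).symm⟩
  · have hinj : Function.Injective fun v : {v // v ≠ q} => p v.1 v.2 := by
      intro a b hab
      have := congrArg G.head hab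
      simp only [hph] at this
      exact Subtype.ext this
    rw [Finset.card_image_of_injective _ hinj, Finset.card_univ, Fintype.card_subtype_compl,
      Fintype.card_subtype_eq]
    exact Nat.sub_add_cancel (Fintype.card_pos_iff.2 ⟨q⟩)
  · have hlt : ∀ a b, Relation.TransGen (G.Step (T : Set E)) a b → d a < d b := by
      intro a b hab
      induction hab with
      | single h => exact (hstep _ _ h).1
      | tail _ h ih => exact ih.trans (hstep _ _ h).1
    exact fun v hv => lt_irrefl _ (hlt v v hv)
  · intro v
    constructor
    · intro hv
      by_contra hvq
      exact hv (p v hvq) ((hT _).2 ⟨v, hvq, rfl⟩) (hph v hvq)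
    · rintro rfl e he
      exact (hstep _ _ ⟨e, he, rfl, rfl⟩).2

section Tree

variable [Fintype V] {T : Finset E}

theorem IsOrientedSpanningTree.exists_head_eq (hT : G.IsOrientedSpanningTree q T) {v : V}
    (hv : v ≠ q) : ∃ e ∈ T, G.head e = v := by
  by_contra! h
  exact hv ((hT.unique_source v).1 h)

/-- Acyclicity on a finite vertex set makes the walk relation well founded, and every vertex except
q has a predecessor. -/
theorem IsOrientedSpanningTree.reaches (hT : G.IsOrientedSpanningTree q T) (v : V) :
    Relation.ReflTransGen (G.Step (T : Set E)) q v := by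
  have : IsTrans V (Relation.TransGen (G.Step (T : Set E))) := ⟨fun _ _ _ => .trans⟩
  have : Std.Irrefl (Relation.TransGen (G.Step (T : Set E))) := ⟨hT.acyclic⟩
  induction v using
    (Finite.wellFounded_of_trans_of_irrefl (Relation.TransGen (G.Step (T : Set E)))).induction with
  | _ v ih =>
    by_cases hv : v = q
    · rw [hv]
    · obtain ⟨e, he, rfl⟩ := hT.exists_head_eq hv
      have hs : G.Step (T : Set E) (G.tail e) (G.head e) := ⟨e, he, rfl, rfl⟩
      exact (ih _ (.single hs)).tail hs

/-- Heads map the n-1 edges onto the n-1 vertices other than q, hence injectively. -/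
theorem IsOrientedSpanningTree.isTransversal [DecidableEq V] (hT : G.IsOrientedSpanningTree q T) :
    G.IsTransversal q Set.univ T := by
  have himage : T.image G.head = Finset.univ.erase q := by
    ext v
    simp only [Finset.mem_image, Finset.mem_erase, Finset.mem_univ, and_true]
    refine ⟨?_, hT.exists_head_eq⟩
    rintro ⟨e, he, rfl⟩
    exact (hT.unique_source q).2 rfl e he
  have hinj : Set.InjOn G.head T := by
    rw [← Finset.card_image_iff, himage, Finset.card_erase_of_mem (Finset.mem_univ _),
      Finset.card_univ, ← hT.card_add_one, Nat.add_sub_cancel]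
  intro v
  constructor
  · rintro ⟨-, hv⟩
    obtain ⟨e, he, rfl⟩ := hT.exists_head_eq hv
    refine ⟨e, ?_⟩
    ext e'
    simp only [Finset.mem_filter, Finset.mem_singleton]
    exact ⟨fun h => hinj h.1 he h.2, by rintro rfl; exact ⟨he, rfl⟩⟩
  · intro h
    have hv : v = q := by simpa using h
    exact Finset.filter_eq_empty_iff.2 fun e he => hv ▸ (hT.unique_source q).2 rfl e he

theorem IsOrientedSpanningTree.eq_of_subset {T' : Finset E} (hT : G.IsOrientedSpanningTree q T)
    (hT' : G.IsOrientedSpanningTree q T') (h : T ⊆ T') : T = T' :=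
  Finset.eq_of_subset_of_card_le h (by have := hT.card_add_one; have := hT'.card_add_one; omega)

end Tree

/-! ### The cut ideal -/

theorem treeIdeal_le_treeIdeal_iff (k : Type*) [Field k] {T T' : Finset E} :
    treeIdeal k T ≤ treeIdeal k T' ↔ T ⊆ T' := by
  constructor
  · intro h e he
    have h1 := h (Ideal.subset_span ⟨e, he, rfl⟩)
    rw [treeIdeal_eq_sqfreeIdeal, ← Finset.prod_singleton MvPolynomial.X e,
      prod_X_mem_sqfreeIdeal] at h1
    obtain ⟨_, ⟨e', he', rfl⟩, h2⟩ := h1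
    rwa [← Finset.singleton_subset_singleton.1 h2]
  · exact fun h => Ideal.span_mono (Set.image_mono h)

section CutIdeal

variable [Fintype E] [DecidableEq V]

/-- The connected cuts whose complement contains the root. -/
def connectedCuts (G : DirectedMultigraph V E) (q : V) : Set (Finset E) :=
  {F | ∃ A : Finset V, q ∉ A ∧ G.InducesConnected (A : Set V) ∧
    G.InducesConnected ((A : Set V)ᶜ) ∧ F = G.cut A}

theorem cutIdeal_eq_sqfreeIdeal (k : Type*) [Field k] :
    G.cutIdeal k q = sqfreeIdeal k (G.connectedCuts q) := by
  rw [cutIdeal, sqfreeIdeal]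
  congr 1
  ext f
  constructor
  · rintro ⟨A, h1, h2, h3, rfl⟩
    exact ⟨_, ⟨A, h1, h2, h3, rfl⟩, rfl⟩
  · rintro ⟨_, ⟨A, h1, h2, h3, rfl⟩, rfl⟩
    exact ⟨A, h1, h2, h3, rfl⟩

theorem IsConnected.exists_connectedCuts_subset_iff [Fintype V] [DecidableEq E] (hG : G.IsConnected)
    (s : Finset E) :
    (∃ F ∈ G.connectedCuts q, F ⊆ s) ↔ ∀ T, G.IsOrientedSpanningTree q T → ¬ T ⊆ sᶜ := by
  constructor
  · rintro ⟨_, ⟨A, h1, h2, -, rfl⟩, hs⟩ T hT hTs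
    have hA : A.Nonempty := by
      obtain ⟨a, ha⟩ := h2.nonempty
      exact ⟨a, ha⟩
    obtain ⟨e, he, hec⟩ := exists_mem_cut_of_reaches hT.reaches hA h1
    exact Finset.mem_compl.1 (hTs he) (hs hec)
  · intro h
    have hns : ¬ ∀ v, Relation.ReflTransGen (G.Step ((sᶜ : Finset E) : Set E)) q v := by
      intro hr
      obtain ⟨T, hTs, hT⟩ := exists_isOrientedSpanningTree_subset hr
      exact h T hT hTs
    obtain ⟨A, h1, h2, h3, h4⟩ := hG.exists_connected_cut hns
    refine ⟨_, ⟨A, h1, h2, h3, rfl⟩, fun e he => ?_⟩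
    by_contra hes
    exact h4 e (by simpa using hes) he

variable [Fintype V] [DecidableEq E] (k : Type*) [Field k]

/-- Any cut of a nonempty set avoiding q meets every tree, so it contains a connected cut. Arbitrary
cuts, unlike the connected ones, need no connectivity check under deletion and contraction. -/
theorem IsConnected.cutIdeal_eq_minorFamily (hG : G.IsConnected) :
    G.cutIdeal k q = sqfreeIdeal k (G.minorFamily {q} ∅ Finset.univ) := by
  rw [cutIdeal_eq_sqfreeIdeal]
  refine le_antisymm (sqfreeIdeal_le k ?_) (sqfreeIdeal_le k ?_)
  · rintro _ ⟨A, h1, h2, -, rfl⟩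
    obtain ⟨a, ha⟩ := h2.nonempty
    exact ⟨G.cut A, Or.inr ⟨A, ⟨a, ha⟩, Finset.disjoint_singleton_right.2 h1, by simp⟩, subset_rfl⟩
  · rintro F (⟨w, hw, rfl⟩ | ⟨B, hB, hBq, rfl⟩)
    · simp at hw
    · rw [Finset.inter_univ, hG.exists_connectedCuts_subset_iff]
      intro T hT hTB
      obtain ⟨e, he, hec⟩ := exists_mem_cut_of_reaches hT.reaches hB
        (Finset.disjoint_singleton_right.1 hBq)
      exact Finset.mem_compl.1 (hTB he) hec

theorem IsConnected.cutIdeal_eq_iInf (hG : G.IsConnected) :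
    G.cutIdeal k q = ⨅ T ∈ {T : Finset E | G.IsOrientedSpanningTree q T}, treeIdeal k T := by
  ext f
  rw [cutIdeal_eq_sqfreeIdeal, mem_sqfreeIdeal]
  simp only [hG.exists_connectedCuts_subset_iff, Submodule.mem_iInf, Set.mem_ofPred_eq, treeIdeal,
    MvPolynomial.mem_ideal_span_X_image, Finset.not_subset, Finset.mem_compl, not_not,
    Finsupp.mem_support_iff, Finset.mem_coe]
  tauto

theorem IsConnected.mem_faces_cutComplex (hG : G.IsConnected) {s : Finset E} :
    s ∈ (G.cutComplex k q).faces ↔ ∃ T, G.IsOrientedSpanningTree q T ∧ T ⊆ sᶜ := by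
  change ¬ (_ ∈ G.cutIdeal k q) ↔ _
  rw [cutIdeal_eq_sqfreeIdeal, prod_X_mem_sqfreeIdeal, hG.exists_connectedCuts_subset_iff]
  push Not
  rfl

/-- Faces are the sets disjoint from some tree. Complements of trees are maximal because no tree
properly contains another. -/
theorem IsConnected.mem_facets_cutComplex (hG : G.IsConnected) {s : Finset E} :
    s ∈ (G.cutComplex k q).facets ↔ G.IsOrientedSpanningTree q sᶜ := by
  constructor
  · intro hs
    obtain ⟨T, hT, hTs⟩ := (hG.mem_faces_cutComplex k).1 hs.prop
    have hle : s ≤ Tᶜ := Finset.subset_compl_comm.1 hTs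
    have := hs.eq_of_le ((hG.mem_faces_cutComplex k).2 ⟨T, hT, by rw [compl_compl]⟩) hle
    rwa [this, compl_compl]
  · intro hs
    refine ⟨(hG.mem_faces_cutComplex k).2 ⟨_, hs, subset_rfl⟩, fun t ht hst => ?_⟩
    obtain ⟨T, hT, hTt⟩ := (hG.mem_faces_cutComplex k).1 ht
    have h1 : T = sᶜ := hT.eq_of_subset hs (hTt.trans (Finset.compl_subset_compl.2 hst))
    subst h1
    exact Finset.compl_subset_compl.1 hTt

/-- A prime containing a finite intersection contains one of its members. -/
theorem IsConnected.exists_treeIdeal_le (hG : G.IsConnected) {p : Ideal (MvPolynomial E k)}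
    (hp : p.IsPrime) (h : G.cutIdeal k q ≤ p) : ∃ T, G.IsOrientedSpanningTree q T ∧ treeIdeal k T ≤ p := by
  classical
  have h1 : (Finset.univ.filter fun T => G.IsOrientedSpanningTree q T).inf (treeIdeal k) ≤ p := by
    refine le_trans (le_of_eq ?_) h
    rw [hG.cutIdeal_eq_iInf k, Finset.inf_eq_iInf]
    simp
  obtain ⟨T, hT, hTp⟩ := hp.inf_le'.1 h1
  exact ⟨T, (Finset.mem_filter.1 hT).2, hTp⟩

theorem IsConnected.bijOn_minimalPrimes_cutIdeal (hG : G.IsConnected) :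
    Set.BijOn (fun T : Finset E => treeIdeal k T) {T | G.IsOrientedSpanningTree q T}
      (G.cutIdeal k q).minimalPrimes := by
  have hle : ∀ T, G.IsOrientedSpanningTree q T → G.cutIdeal k q ≤ treeIdeal k T := by
    intro T hT
    rw [hG.cutIdeal_eq_iInf k]
    exact iInf₂_le T hT
  refine ⟨fun T hT => ⟨⟨hT.isTransversal.isPrime_treeIdeal k, hle T hT⟩, ?_⟩, ?_, ?_⟩
  · rintro p ⟨hp, hCp⟩ hpT
    obtain ⟨T', hT', hT'p⟩ := hG.exists_treeIdeal_le k hp hCp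
    have := hT'.eq_of_subset hT ((treeIdeal_le_treeIdeal_iff k).1 (hT'p.trans hpT))
    exact this ▸ hT'p
  · intro T _ T' _ h
    exact ((treeIdeal_le_treeIdeal_iff k).1 h.le).antisymm ((treeIdeal_le_treeIdeal_iff k).1 h.ge)
  · intro p hp
    obtain ⟨T, hT, hTp⟩ := hG.exists_treeIdeal_le k hp.1.1 hp.1.2
    exact ⟨T, hT, hTp.antisymm (hp.2 ⟨hT.isTransversal.isPrime_treeIdeal k, hle T hT⟩ hTp)⟩

/-- The face ring of the cut complex is Cohen–Macaulay, of dimension `|E| - |V| + 1` if there is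
an oriented spanning tree. -/
theorem IsConnected.isCohenMacaulay_and_ringKrullDim (hG : G.IsConnected) {T₀ : Finset E}
    (hT₀ : G.IsOrientedSpanningTree q T₀) :
    IsCohenMacaulay (MvPolynomial E k ⧸ G.cutIdeal k q) ∧
      ringKrullDim (MvPolynomial E k ⧸ G.cutIdeal k q) = Fintype.card {e // e ∉ T₀} := by
  let _ : Algebra (MvPolynomial {e // e ∉ T₀} k) (MvPolynomial E k) :=
    (G.paramHom k T₀ : MvPolynomial {e // e ∉ T₀} k →+* MvPolynomial E k).toAlgebra
  -- Start with nothing deleted or contracted; the empty set is a transversal of {q} because the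
  -- root needs no incoming edge.
  have hfp := finite_projective_quotient_minorFamily k (fun _ => rfl) hT₀.isTransversal
    Finset.univ {q} ∅ (Finset.mem_singleton_self q)
    (fun v => ⟨fun h => absurd (by simpa using h.1) h.2, by simp⟩)
  rw [← hG.cutIdeal_eq_minorFamily k] at hfp
  obtain ⟨_, _⟩ := hfp
  have : Nontrivial (MvPolynomial E k ⧸ G.cutIdeal k q) := by
    refine Ideal.Quotient.nontrivial_iff.2 fun h => ?_
    have hle : G.cutIdeal k q ≤ treeIdeal k T₀ := by
      rw [hG.cutIdeal_eq_iInf k]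
      exact iInf₂_le T₀ hT₀
    exact (hT₀.isTransversal.isPrime_treeIdeal k).ne_top (top_le_iff.1 (h ▸ hle))
  exact ⟨isCohenMacaulay_of_finite_flat_mvPolynomial (σ := {e // e ∉ T₀}) (k := k),
    ringKrullDim_eq_card_of_finite_flat_mvPolynomial (k := k)⟩

theorem IsConnected.isCohenMacaulay_quotient_cutIdeal (hG : G.IsConnected) :
    IsCohenMacaulay (MvPolynomial E k ⧸ G.cutIdeal k q) := by
  by_cases h : ∃ T, G.IsOrientedSpanningTree q T
  · obtain ⟨T, hT⟩ := h
    exact (hG.isCohenMacaulay_and_ringKrullDim k hT).1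
  -- Without a tree the intersection is empty and the ring is zero.
  · have htop : G.cutIdeal k q = ⊤ := by
      rw [hG.cutIdeal_eq_iInf k]
      simp only [Set.mem_ofPred_eq, iInf_eq_top]
      exact fun T hT => absurd ⟨T, hT⟩ h
    have : Subsingleton (MvPolynomial E k ⧸ G.cutIdeal k q) := Ideal.Quotient.subsingleton_iff.2 htop
    exact ⟨inferInstance, fun m hm => absurd (Subsingleton.elim m ⊤) hm.ne_top⟩

end CutIdeal

end DirectedMultigraph

end

theorem proposition4p5 {V E : Type*} [Fintype V] [DecidableEq V] [Fintype E] [DecidableEq E]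
    (G : DirectedMultigraph V E) (hG : G.IsConnected) (q : V) (k : Type*) [Field k] :
    -- (i) the facets are the complements of the oriented spanning trees, bijectively
    (Set.BijOn (fun T : Finset E => Tᶜ) {T | G.IsOrientedSpanningTree q T}
        (G.cutComplex k q).facets ∧
      (G.cutComplex k q).facets.ncard = {T : Finset E | G.IsOrientedSpanningTree q T}.ncard) ∧
    -- (ii) the minimal prime decomposition
    (G.cutIdeal k q =
        ⨅ T ∈ {T : Finset E | G.IsOrientedSpanningTree q T},
          DirectedMultigraph.treeIdeal k T ∧
      Set.BijOn (fun T : Finset E => DirectedMultigraph.treeIdeal k T)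
        {T | G.IsOrientedSpanningTree q T} (G.cutIdeal k q).minimalPrimes) ∧
    -- (iii) purity, and the dimension (which needs every vertex to be reachable from the source)
    ((∀ τ ∈ (G.cutComplex k q).facets, τ.card + Fintype.card V = Fintype.card E + 1) ∧
      ((∀ v, G.Reaches q v) →
        ringKrullDim ((G.cutComplex k q).FaceRing k) + (Fintype.card V : WithBot ℕ∞) =
          (Fintype.card E : WithBot ℕ∞) + 1)) ∧
    -- (iv) Cohen–Macaulayness
    (G.cutComplex k q).IsCohenMacaulay k := by
  have hbij : Set.BijOn (fun T : Finset E => Tᶜ) {T | G.IsOrientedSpanningTree q T}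
      (G.cutComplex k q).facets := by
    refine ⟨fun T hT => ?_, compl_injective.injOn, fun s hs => ?_⟩
    · rw [hG.mem_facets_cutComplex k, compl_compl]
      exact hT
    · exact ⟨sᶜ, (hG.mem_facets_cutComplex k).1 hs, compl_compl s⟩
  refine ⟨⟨hbij, hbij.ncard_eq.symm⟩, ⟨hG.cutIdeal_eq_iInf k, hG.bijOn_minimalPrimes_cutIdeal k⟩,
    ⟨fun τ hτ => ?_, fun hr => ?_⟩, ?_⟩
  · have h1 := ((hG.mem_facets_cutComplex k).1 hτ).card_add_one
    have h2 := Finset.card_add_card_compl τ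
    omega
  -- Reachability supplies a tree, which excludes the zero ring and its dimension ⊥.
  · obtain ⟨T, -, hT⟩ := DirectedMultigraph.exists_isOrientedSpanningTree_subset
      (F := Finset.univ) (G := G) (q := q) (by rw [Finset.coe_univ]; exact hr)
    change ringKrullDim (MvPolynomial E k ⧸ (G.cutComplex k q).srIdeal k) + _ = _
    rw [DirectedMultigraph.srIdeal_cutComplex,
      (hG.isCohenMacaulay_and_ringKrullDim k hT).2]
    have h1 := hT.card_add_one
    have h2 := Finset.card_le_univ T
    have h3 : Fintype.card {e // e ∉ T} + Fintype.card V = Fintype.card E + 1 := by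
      rw [Fintype.card_subtype_compl, Fintype.card_coe]
      omega
    exact_mod_cast h3
  · change IsCohenMacaulay (MvPolynomial E k ⧸ (G.cutComplex k q).srIdeal k)
    rw [DirectedMultigraph.srIdeal_cutComplex]
    exact hG.isCohenMacaulay_quotient_cutIdeal k
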